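/- Let $\mathbb{D}=\{z\in\mathbb{C}:|z|<1\}$. Call a holomorphic function $h$ on $\mathbb{D}$ proper if it is proper as a map $h:\mathbb{D}\to h(\mathbb{D})$, i.e. if $\{z\in\mathbb{D}: h(z)\in K\}$ is compact for every compact $K\subset h(\mathbb{D})$. For $h$ holomorphic on $\mathbb{D}$ put $$S(h)=\sum_{a\in\mathbb{D},\,h(a)=0} m_a\log|a|\in[-\infty,0],$$ where $m_a$ is the multiplicity of $a$ as a zero of $h$ (with $m_a=\infty$ if $h\equiv 0$), $\log 0=-\infty$, and $S(h)=0$ if $h$ has no zero in $\mathbb{D}$. Let $f$ be continuous on $\overline{\mathbb{D}}$, and holomorphic and proper on $\mathbb{D}$. Then for every holomorphic $g:\mathbb{D}\to\mathbb{C}$ with $g(\mathbb{D})\subset f(\mathbb{D})$ and $g(0)=f(0)$, $$\sum_{b\in\mathbb{D},\,g(b)=0} m_b\log|b|\;\geq\;\sum_{a\in\mathbb{D},\,f(a)=0} m_a\log|a| .$$ If moreover $g$ is proper and $g(\mathbb{D})=f(\mathbb{D})$, then $$\sum_{b\in\mathbb{D},\,g(b)=0} m_b\log|b|\;=\;\sum_{a\in\mathbb{D},\,f(a)=0}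 m_a\log|a| .$$ -/

import Mathlib

open Metric

/-- A function `h` is proper on the open unit disc, as a map from the disc onto its image
`h(𝔻)` (with the subspace topologies). For `h` holomorphic this means that the preimage in
the disc of every compact subset of `h(𝔻)` is compact. -/
def IsProperOnDisc (h : ℂ → ℂ) : Prop :=
  IsProperMap (Set.imageFactorization h (ball (0 : ℂ) 1))

/-- The term `m_b * log |b|` in `[-∞, 0]`, where `m_b` is the multiplicity of `b` as a zero
of `h`; here `log 0 = -∞` (`ENNReal.log` is the extended logarithm). -/
noncomputable def zeroTerm (h : ℂ → ℂ) (b : ℂ) : EReal :=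
  (((analyticOrderAt h b : ENat) : ENNReal) : EReal) * ENNReal.log ‖b‖ₑ

/-- The sum `∑ m_b * log |b|` over the zeros `b` of `h` in the open unit disc, as an element
of `[-∞, 0]`. It is `0` if there are no zeros. -/
noncomputable def zeroLogSum (h : ℂ → ℂ) : EReal :=
  ∑' b : {b : ℂ // b ∈ ball (0 : ℂ) 1 ∧ h b = 0}, zeroTerm h b

theorem zeroTerm_nonpos (h : ℂ → ℂ) {b : ℂ} (hb : b ∈ ball (0 : ℂ) 1) : zeroTerm h b ≤ 0 := by
  have h1 : ENNReal.log ‖b‖ₑ ≤ 0 := by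
    rw [← ENNReal.log_one]
    apply ENNReal.log_monotone
    have : ‖b‖ < 1 := by simpa using hb
    rw [← ofReal_norm]
    exact ENNReal.ofReal_le_one.2 this.le
  exact mul_nonpos_of_nonneg_of_nonpos (EReal.coe_ennreal_nonneg _) h1

/-- The terms are nonpositive, so the sum always exists in `[-∞, 0]`. -/
theorem hasSum_zeroLogSum (h : ℂ → ℂ) :
    HasSum (fun b : {b : ℂ // b ∈ ball (0 : ℂ) 1 ∧ h b = 0} => zeroTerm h b) (zeroLogSum h) := by
  have hs : Summable
      (fun b : {b : ℂ // b ∈ ball (0 : ℂ) 1 ∧ h b = 0} => zeroTerm h b) := by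
    refine ⟨_, tendsto_atTop_iInf ?_⟩
    intro s t hst
    classical
    change ∑ b ∈ t, zeroTerm h b ≤ ∑ b ∈ s, zeroTerm h b
    rw [← Finset.sum_sdiff hst]
    exact (add_le_add_left (Finset.sum_nonpos fun b _ => zeroTerm_nonpos h b.2.1) _).trans
      (zero_add _).le
  exact hs.hasSum

/-! Suppose `f 0 ≠ 0`; otherwise the sum for `f` is `-∞`. Write `f = B_f * f₁`, where `B_f` is the
Blaschke product of the finitely many zeros of `f` and `f₁` is zero-free. For any finite set of
zeros of `g`, write `g = B_g * g₁`. The sums are the logarithms of `|B_f 0|` and `|B_g 0|`, so the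
claim is `|B_f 0| ≤ |B_g 0|`, which follows from `|g₁ 0| ≤ |f₁ 0|` because `g 0 = f 0`.

On the fibre product `X = {(z, w) : f w = g z}` one has `B_g z * (g₁ z / f₁ w) = B_f w`, of modulus
at most `1`. Since `|B_g z| → 1` at the unit circle, `|g₁ z / f₁ w|` is at most `1` in the limit
there. Properness of `f` makes `X` proper over the `z`-disc, so a maximum principle on `X`
(`norm_mul_le_one_of_fiberProduct`) gives the bound everywhere, in particular at `(0, 0)`. As `X`
may be singular, that principle is applied along holomorphic discs `s ↦ (z + s ^ k, h s)` in `X`,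
supplied by `AnalyticAt.exists_local_lift`. -/

/-! ### Local lifting after a ramified substitution -/

open Filter Topology in
/-- A nonvanishing analytic germ has analytic `k`-th roots. -/
theorem AnalyticAt.exists_eventually_eq_pow {u : ℂ → ℂ} {x : ℂ} (hu : AnalyticAt ℂ u x)
    (hx : u x ≠ 0) {k : ℕ} (hk : k ≠ 0) :
    ∃ v : ℂ → ℂ, AnalyticAt ℂ v x ∧ v x ≠ 0 ∧ ∀ᶠ y in 𝓝 x, u y = v y ^ k := by
  obtain ⟨c, hc⟩ := IsAlgClosed.exists_pow_nat_eq (u x) (Nat.pos_of_ne_zero hk)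
  have hc0 : c ≠ 0 := by
    rintro rfl
    exact hx (by rw [← hc, zero_pow hk])
  -- Dividing by `u x` moves the germ to the value `1`, where the principal logarithm is analytic;
  -- `c` restores the constant.
  refine ⟨fun y => c * Complex.exp (Complex.log (u y / u x) / k), ?_, ?_, ?_⟩
  · refine analyticAt_const.mul (AnalyticAt.cexp (AnalyticAt.div (AnalyticAt.clog
      (hu.div analyticAt_const hx) ?_) analyticAt_const (by exact_mod_cast hk)))
    simp [hx]
  · exact mul_ne_zero hc0 (Complex.exp_ne_zero _)
  · filter_upwards [hu.continuousAt.eventually_ne hx] with y hy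
    rw [mul_pow, hc, ← Complex.exp_nat_mul, mul_div_cancel₀ _ (by exact_mod_cast hk),
      Complex.exp_log (div_ne_zero hy hx), mul_div_cancel₀ _ hx]

open Filter Topology in
/-- Local normal form: a nonconstant analytic germ is a power of a local coordinate. -/
theorem AnalyticAt.exists_eventually_eq_add_pow {f : ℂ → ℂ} {x : ℂ} (hf : AnalyticAt ℂ f x)
    (hne : ¬ ∀ᶠ y in 𝓝 x, f y = f x) :
    ∃ k : ℕ, k ≠ 0 ∧ ∃ ψ : ℂ → ℂ, AnalyticAt ℂ ψ x ∧ ψ x = 0 ∧ deriv ψ x ≠ 0 ∧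
      ∀ᶠ y in 𝓝 x, f y = f x + ψ y ^ k := by
  obtain ⟨k, u, hu, hux, hfu⟩ :=
    (hf.sub analyticAt_const).exists_eventuallyEq_pow_smul_nonzero_iff.2
      (by simpa [sub_eq_zero] using hne)
  have hk : k ≠ 0 := by
    rintro rfl
    have := hfu.self_of_nhds
    simp at this
    exact hux this.symm
  obtain ⟨v, hv, hvx, huv⟩ := hu.exists_eventually_eq_pow hux hk
  have hd : HasDerivAt (fun y => (y - x) * v y) (v x) x := by
    simpa using ((hasDerivAt_id x).sub_const x).fun_mul hv.differentiableAt.hasDerivAt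
  refine ⟨k, hk, fun y => (y - x) * v y, (analyticAt_id.sub analyticAt_const).mul hv, by simp,
    by rwa [hd.deriv], ?_⟩
  filter_upwards [hfu, huv] with y h1 h2
  simp only [Pi.sub_apply, smul_eq_mul, h2, ← mul_pow] at h1
  rw [← h1]
  ring

open Filter Topology in
/-- After the substitution `z ↦ z + s ^ k`, an analytic germ becomes a constant plus a `k`-th
power. -/
theorem AnalyticAt.exists_comp_add_pow_eq_add_pow {g : ℂ → ℂ} {z : ℂ} (hg : AnalyticAt ℂ g z)
    {k : ℕ} (hk : k ≠ 0) :
    ∃ r : ℂ → ℂ, AnalyticAt ℂ r 0 ∧ r 0 = 0 ∧ ∀ᶠ s in 𝓝 (0 : ℂ), g (z + s ^ k) = g z + r s ^ k := by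
  have hp : AnalyticAt ℂ (fun s : ℂ => z + s ^ k) 0 :=
    analyticAt_const.add (analyticAt_id.pow k)
  have hp0 : (fun s : ℂ => z + s ^ k) 0 = z := by simp [hk]
  have ht : Tendsto (fun s : ℂ => z + s ^ k) (𝓝 0) (𝓝 z) := by
    simpa only [hp0] using hp.continuousAt.tendsto
  by_cases hc : ∀ᶠ y in 𝓝 z, g y = g z
  · refine ⟨fun _ => 0, analyticAt_const, rfl, ?_⟩
    filter_upwards [ht.eventually hc] with s hs
    simp [hs, hk]
  obtain ⟨m, u, hu, huz, hgu⟩ :=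
    (hg.sub analyticAt_const).exists_eventuallyEq_pow_smul_nonzero_iff.2
      (by simpa [sub_eq_zero] using hc)
  have hm : m ≠ 0 := by
    rintro rfl
    have := hgu.self_of_nhds
    simp at this
    exact huz this.symm
  obtain ⟨v, hv, -, huv⟩ := hu.exists_eventually_eq_pow huz hk
  -- With `g y - g z = (y - z) ^ m * v y ^ k`, setting `y = z + s ^ k` makes the first factor `(s ^
  -- m) ^ k`.
  refine ⟨fun s => s ^ m * v (z + s ^ k), (analyticAt_id.pow m).mul
    (AnalyticAt.fun_comp (by simpa [hk] using hv) hp), by simp [hm], ?_⟩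
  filter_upwards [ht.eventually hgu, ht.eventually huv] with s h1 h2
  simp only [Pi.sub_apply, smul_eq_mul, h2, add_sub_cancel_left] at h1
  rw [mul_pow, ← pow_mul, mul_comm m k, pow_mul, ← h1]
  ring

open Filter Topology in
/-- If `f w = g z`, then after a ramified substitution `z + s ^ k` the germ of `g` at `z` lifts
through the nonconstant germ of `f` at `w`. -/
theorem AnalyticAt.exists_local_lift {f g : ℂ → ℂ} {w z : ℂ} (hf : AnalyticAt ℂ f w)
    (hg : AnalyticAt ℂ g z) (hfg : f w = g z) (hne : ¬ ∀ᶠ y in 𝓝 w, f y = f w) :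
    ∃ k : ℕ, k ≠ 0 ∧ ∃ h : ℂ → ℂ, AnalyticAt ℂ h 0 ∧ h 0 = w ∧
      ∀ᶠ s in 𝓝 (0 : ℂ), f (h s) = g (z + s ^ k) := by
  obtain ⟨k, hk, ψ, hψ, hψw, hψ', hfψ⟩ := hf.exists_eventually_eq_add_pow hne
  obtain ⟨r, hr, hr0, hgr⟩ := hg.exists_comp_add_pow_eq_add_pow (z := z) hk
  have hφ := hψ.analyticAt_localInverse hψ'
  set φ := hψ.hasStrictDerivAt.localInverse _ _ _ hψ'
  have hφw : φ (ψ w) = w := HasStrictFDerivAt.localInverse_apply_image ..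
  have hψφ : ∀ᶠ y in 𝓝 (ψ w), ψ (φ y) = y := HasStrictDerivAt.eventually_right_inverse ..
  rw [hψw] at hφ hφw hψφ
  have hrt : Tendsto r (𝓝 0) (𝓝 0) := by simpa only [hr0] using hr.continuousAt.tendsto
  have hφt : Tendsto φ (𝓝 0) (𝓝 w) := by simpa only [hφw] using hφ.continuousAt.tendsto
  refine ⟨k, hk, fun s => φ (r s), AnalyticAt.fun_comp (by rwa [hr0]) hr, by simp only [hr0, hφw], ?_⟩
  filter_upwards [hgr, hrt.eventually hψφ, (hφt.comp hrt).eventually hfψ] with s h1 h2 h3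
  simp only [Function.comp_apply] at h3
  rw [h3, h2, h1, hfg]

/-! ### Finite Blaschke products -/

/-- The disc automorphism factor vanishing at `b`. -/
noncomputable def blaschkeFactor (b z : ℂ) : ℂ := (z - b) / (1 - (starRingEnd ℂ) b * z)

theorem blaschkeFactor_denom_ne_zero {b z : ℂ} (hb : ‖b‖ < 1) (hz : ‖z‖ ≤ 1) :
    1 - (starRingEnd ℂ) b * z ≠ 0 := by
  intro h
  have h1 : ‖(starRingEnd ℂ) b * z‖ = 1 := by rw [← sub_eq_zero.1 h, norm_one]
  rw [norm_mul, RCLike.norm_conj] at h1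
  nlinarith [norm_nonneg b, norm_nonneg z]

theorem blaschkeFactor_zero (b : ℂ) : blaschkeFactor b 0 = -b := by simp [blaschkeFactor]

theorem blaschkeFactor_ne_zero {b z : ℂ} (hb : ‖b‖ < 1) (hz : ‖z‖ ≤ 1) (h : z ≠ b) :
    blaschkeFactor b z ≠ 0 :=
  div_ne_zero (sub_ne_zero.2 h) (blaschkeFactor_denom_ne_zero hb hz)

/-- The right side is nonnegative on the closed disc and zero on the circle, which controls the
modulus of a Blaschke factor in both places. -/
theorem normSq_one_sub_conj_mul_sub_normSq_sub (b z : ℂ) :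
    ‖1 - (starRingEnd ℂ) b * z‖ ^ 2 - ‖z - b‖ ^ 2 = (1 - ‖b‖ ^ 2) * (1 - ‖z‖ ^ 2) := by
  simp only [← Complex.normSq_eq_norm_sq, Complex.normSq_apply, Complex.sub_re, Complex.sub_im,
    Complex.mul_re, Complex.mul_im, Complex.conj_re, Complex.conj_im, Complex.one_re,
    Complex.one_im]
  ring

theorem norm_blaschkeFactor_le_one {b z : ℂ} (hb : ‖b‖ < 1) (hz : ‖z‖ ≤ 1) :
    ‖blaschkeFactor b z‖ ≤ 1 := by
  rw [blaschkeFactor, norm_div]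
  refine div_le_one_of_le₀ ?_ (norm_nonneg _)
  refine le_of_sq_le_sq ?_ (norm_nonneg _)
  have h := normSq_one_sub_conj_mul_sub_normSq_sub b z
  have h1 : 0 ≤ 1 - ‖b‖ ^ 2 := by nlinarith [norm_nonneg b]
  have h2 : 0 ≤ 1 - ‖z‖ ^ 2 := by nlinarith [norm_nonneg z]
  nlinarith [mul_nonneg h1 h2]

theorem norm_blaschkeFactor_eq_one {b z : ℂ} (hb : ‖b‖ < 1) (hz : ‖z‖ = 1) :
    ‖blaschkeFactor b z‖ = 1 := by
  rw [blaschkeFactor, norm_div]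
  have h := normSq_one_sub_conj_mul_sub_normSq_sub b z
  rw [hz] at h
  have h0 := norm_ne_zero_iff.2 (blaschkeFactor_denom_ne_zero hb hz.le)
  rw [div_eq_one_iff_eq h0]
  exact (sq_eq_sq₀ (norm_nonneg _) (norm_nonneg _)).1 (by linarith)

theorem analyticAt_blaschkeFactor {b z : ℂ} (hb : ‖b‖ < 1) (hz : ‖z‖ ≤ 1) :
    AnalyticAt ℂ (blaschkeFactor b) z :=
  (analyticAt_id.sub analyticAt_const).div
    (analyticAt_const.sub (analyticAt_const.mul analyticAt_id))
    (blaschkeFactor_denom_ne_zero hb hz)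

/-- The finite Blaschke product whose zeros are the points of `S`, with their multiplicities as
zeros of `h`. -/
noncomputable def zeroProduct (h : ℂ → ℂ) (S : Finset ℂ) (z : ℂ) : ℂ :=
  ∏ b ∈ S, blaschkeFactor b z ^ analyticOrderNatAt h b

section zeroProduct

variable {h : ℂ → ℂ} {S : Finset ℂ} {z : ℂ}

theorem analyticAt_zeroProduct (hS : ∀ b ∈ S, ‖b‖ < 1) (hz : ‖z‖ ≤ 1) :
    AnalyticAt ℂ (zeroProduct h S) z :=
  Finset.analyticAt_fun_prod S fun b hb => (analyticAt_blaschkeFactor (hS b hb) hz).pow _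

theorem norm_zeroProduct_le_one (hS : ∀ b ∈ S, ‖b‖ < 1) (hz : ‖z‖ ≤ 1) :
    ‖zeroProduct h S z‖ ≤ 1 := by
  rw [zeroProduct, norm_prod]
  refine Finset.prod_le_one (fun _ _ => norm_nonneg _) fun b hb => ?_
  rw [norm_pow]
  exact pow_le_one₀ (norm_nonneg _) (norm_blaschkeFactor_le_one (hS b hb) hz)

theorem norm_zeroProduct_eq_one (hS : ∀ b ∈ S, ‖b‖ < 1) (hz : ‖z‖ = 1) :
    ‖zeroProduct h S z‖ = 1 := by
  rw [zeroProduct, norm_prod]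
  refine Finset.prod_eq_one fun b hb => ?_
  rw [norm_pow, norm_blaschkeFactor_eq_one (hS b hb) hz, one_pow]

theorem zeroProduct_ne_zero (hS : ∀ b ∈ S, ‖b‖ < 1) (hz : ‖z‖ ≤ 1) (hzS : z ∉ S) :
    zeroProduct h S z ≠ 0 :=
  Finset.prod_ne_zero_iff.2 fun b hb => pow_ne_zero _
    (blaschkeFactor_ne_zero (hS b hb) hz fun e => hzS (e ▸ hb))

/-- A finite Blaschke product has modulus close to `1` near the unit circle. -/
theorem exists_lt_norm_zeroProduct (hS : ∀ b ∈ S, ‖b‖ < 1) {c : ℝ} (hc : c < 1) :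
    ∃ r < 1, ∀ z : ℂ, r < ‖z‖ → ‖z‖ < 1 → c < ‖zeroProduct h S z‖ := by
  set K : Set ℂ := {z | z ∈ closedBall 0 1 ∧ ‖zeroProduct h S z‖ ∈ Set.Iic c}
  have hcont : ContinuousOn (fun z => ‖zeroProduct h S z‖) (closedBall 0 1) := fun z hz =>
    (analyticAt_zeroProduct hS (by simpa using hz)).continuousAt.norm.continuousWithinAt
  have hK : IsCompact K := (isCompact_closedBall 0 1).of_isClosed_subset
    (hcont.preimage_isClosed_of_isClosed isClosed_closedBall isClosed_Iic) fun z hz => hz.1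
  rcases K.eq_empty_or_nonempty with hKe | hKn
  · refine ⟨0, one_pos, fun z _ hz => ?_⟩
    by_contra! hle
    exact (hKe ▸ (show z ∈ K from ⟨by simpa using hz.le, hle⟩) : z ∈ (∅ : Set ℂ))
  -- The radius is that of a point of the compact set `K` farthest from `0`; it is below `1` because
  -- the modulus is `1` on the circle.
  · obtain ⟨x, hx, hmax⟩ := hK.exists_isMaxOn hKn continuous_norm.continuousOn
    refine ⟨‖x‖, lt_of_le_of_ne (by simpa using hx.1) fun e => ?_, fun z hxz hz => ?_⟩
    · exact (hx.2.trans_lt hc).ne (norm_zeroProduct_eq_one hS e)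
    · by_contra! hle
      exact hxz.not_ge (hmax (show z ∈ K from ⟨by simpa using hz.le, hle⟩))

end zeroProduct

open Filter Topology in
/-- Dividing a zero of finite order out of a holomorphic function on the disc. -/
theorem exists_eq_blaschkeFactor_pow_mul {h : ℂ → ℂ} (hh : AnalyticOnNhd ℂ h (ball 0 1)) {b : ℂ}
    (hb : b ∈ ball (0 : ℂ) 1) (hord : analyticOrderAt h b ≠ ⊤) :
    ∃ h₁ : ℂ → ℂ, AnalyticOnNhd ℂ h₁ (ball 0 1) ∧ h₁ b ≠ 0 ∧
      ∀ z ∈ ball (0 : ℂ) 1, h z = blaschkeFactor b z ^ analyticOrderNatAt h b * h₁ z := by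
  have hb1 : ‖b‖ < 1 := by simpa using hb
  obtain ⟨u, hu, hub, huh⟩ := (hh b hb).analyticOrderAt_ne_top.1 hord
  set m := analyticOrderNatAt h b
  -- The extra factor cancels the denominators of the Blaschke factors.
  set U : ℂ → ℂ := fun z => u z * (1 - (starRingEnd ℂ) b * z) ^ m
  have hU : AnalyticAt ℂ U b :=
    hu.mul ((analyticAt_const.sub (analyticAt_const.mul analyticAt_id)).pow m)
  have hfac : ∀ᶠ z in 𝓝 b, h z = blaschkeFactor b z ^ m * U z := by
    filter_upwards [huh, isOpen_ball.mem_nhds hb] with z hz hz1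
    have := blaschkeFactor_denom_ne_zero hb1 (z := z) (by simpa using (mem_ball_zero_iff.1 hz1).le)
    simp only [hz, U, blaschkeFactor, div_pow, smul_eq_mul]
    rw [div_mul_eq_mul_div, ← mul_assoc, mul_div_cancel_right₀ _ (pow_ne_zero _ this)]
  have hball : ∀ z ∈ ball (0 : ℂ) 1, z ≠ b → blaschkeFactor b z ≠ 0 := fun z hz hzb =>
    blaschkeFactor_ne_zero hb1 (mem_ball_zero_iff.1 hz).le hzb
  set h₁ : ℂ → ℂ := Function.update (fun z => h z / blaschkeFactor b z ^ m) b (U b)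
  have hloc : U =ᶠ[𝓝 b] h₁ := by
    filter_upwards [hfac, isOpen_ball.mem_nhds hb] with z hz hz1
    by_cases hzb : z = b
    · simp [h₁, hzb]
    · simp only [h₁, Function.update_of_ne hzb, hz]
      rw [mul_div_cancel_left₀ _ (pow_ne_zero _ (hball z hz1 hzb))]
  have hUb : U b ≠ 0 := mul_ne_zero hub (pow_ne_zero _ (blaschkeFactor_denom_ne_zero hb1 hb1.le))
  refine ⟨h₁, fun z hz => ?_, by simpa [h₁] using hUb, fun z hz => ?_⟩
  · by_cases hzb : z = b
    · exact hzb ▸ hU.congr hloc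
    · have hz1 : ‖z‖ ≤ 1 := (mem_ball_zero_iff.1 hz).le
      refine ((hh z hz).div ((analyticAt_blaschkeFactor hb1 hz1).pow m)
        (pow_ne_zero _ (hball z hz hzb))).congr ?_
      filter_upwards [isOpen_ne.mem_nhds hzb] with y hy
      simp [h₁, Function.update_of_ne hy]
  · by_cases hzb : z = b
    · rw [hzb, hfac.self_of_nhds]
      simp [h₁]
    · simp only [h₁, Function.update_of_ne hzb]
      rw [mul_div_cancel₀ _ (pow_ne_zero _ (hball z hz hzb))]

open Filter Topology in
/-- Dividing finitely many zeros of finite order out of a holomorphic function on the disc. -/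
theorem exists_eq_zeroProduct_mul {h : ℂ → ℂ} (hh : AnalyticOnNhd ℂ h (ball 0 1)) (S : Finset ℂ)
    (hS : ∀ b ∈ S, ‖b‖ < 1) (hord : ∀ b ∈ ball (0 : ℂ) 1, analyticOrderAt h b ≠ ⊤) :
    ∃ h₁ : ℂ → ℂ, AnalyticOnNhd ℂ h₁ (ball 0 1) ∧ (∀ b ∈ S, h₁ b ≠ 0) ∧
      ∀ z ∈ ball (0 : ℂ) 1, h z = zeroProduct h S z * h₁ z := by
  induction S using Finset.induction_on with
  | empty => exact ⟨h, hh, by simp, by simp [zeroProduct]⟩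
  | insert b S hbS ih =>
    have hS' : ∀ c ∈ S, ‖c‖ < 1 := fun c hc => hS c (Finset.mem_insert_of_mem hc)
    have hb1 : ‖b‖ < 1 := hS b (Finset.mem_insert_self b S)
    have hb : b ∈ ball (0 : ℂ) 1 := by simpa using hb1
    obtain ⟨h₁, hh₁, hne, heq⟩ := ih hS'
    have hP := analyticAt_zeroProduct (h := h) hS' hb1.le
    have hP0 := zeroProduct_ne_zero (h := h) hS' hb1.le hbS
    -- The factors already removed do not vanish at `b`, so the order there is unchanged.
    have ho : analyticOrderAt h b = analyticOrderAt h₁ b := by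
      have : h =ᶠ[𝓝 b] zeroProduct h S * h₁ := by
        filter_upwards [isOpen_ball.mem_nhds hb] with z hz using heq z hz
      rw [analyticOrderAt_congr this, analyticOrderAt_mul hP (hh₁ b hb),
        analyticOrderAt_eq_zero.2 (Or.inr hP0), zero_add]
    obtain ⟨h₂, hh₂, hb₂, heq₂⟩ := exists_eq_blaschkeFactor_pow_mul hh₁ hb (ho ▸ hord b hb)
    refine ⟨h₂, hh₂, fun c hc => ?_, fun z hz => ?_⟩
    · rcases Finset.mem_insert.1 hc with rfl | hcS
      · exact hb₂
      · intro h0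
        exact hne c hcS (by rw [heq₂ c (by simpa using hS' c hcS), h0, mul_zero])
    · rw [heq z hz, heq₂ z hz, zeroProduct, zeroProduct, Finset.prod_insert hbS]
      simp only [analyticOrderNatAt, ho]
      ring

/-! ### Consequences of properness -/

theorem IsProperOnDisc.isCompact_preimage {f : ℂ → ℂ} (hf : IsProperOnDisc f) {K : Set ℂ}
    (hK : IsCompact K) (hKf : K ⊆ f '' ball 0 1) : IsCompact {z | z ∈ ball (0 : ℂ) 1 ∧ f z ∈ K} := by
  have hK' : IsCompact ((↑) ⁻¹' K : Set (f '' ball (0 : ℂ) 1)) := by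
    rw [Subtype.isCompact_iff, Subtype.image_preimage_coe, Set.inter_eq_self_of_subset_right hKf]
    exact hK
  convert (IsProperMap.isCompact_preimage hf hK').image continuous_subtype_val using 1
  ext z
  simp [Set.imageFactorization, and_comm]

theorem not_isCompact_unit_ball : ¬ IsCompact (ball (0 : ℂ) 1) := fun h => by
  have h1 := h.isClosed.closure_eq
  rw [closure_ball (0 : ℂ) one_ne_zero] at h1
  have : (1 : ℂ) ∈ closedBall (0 : ℂ) 1 := by simp
  rw [h1] at this
  simp at this

open Filter Topology in
/-- A proper holomorphic function on the disc is nonconstant near every point. -/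
theorem IsProperOnDisc.not_eventually_eq {f : ℂ → ℂ} (hfp : IsProperOnDisc f)
    (hf : AnalyticOnNhd ℂ f (ball 0 1)) {w : ℂ} (hw : w ∈ ball (0 : ℂ) 1) :
    ¬ ∀ᶠ y in 𝓝 w, f y = f w := fun h => by
  have heq := hf.eqOn_of_preconnected_of_eventuallyEq (g := fun _ => f w) (fun _ _ => analyticAt_const)
    (convex_ball (0 : ℂ) 1).isPreconnected hw h
  have := hfp.isCompact_preimage (isCompact_singleton (x := f w))
    (Set.singleton_subset_iff.2 ⟨w, hw, rfl⟩)
  refine not_isCompact_unit_ball ?_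
  convert this using 1
  ext z
  simpa using fun hz => heq (mem_ball_zero_iff.2 hz)

open Filter Topology in
-- The zero set is empty or a compact fibre; an accumulation point in the disc would force `f` to
-- vanish identically.
theorem IsProperOnDisc.finite_zeros {f : ℂ → ℂ} (hfp : IsProperOnDisc f)
    (hf : AnalyticOnNhd ℂ f (ball 0 1)) (h0 : f 0 ≠ 0) :
    {z | z ∈ ball (0 : ℂ) 1 ∧ f z = 0}.Finite := by
  by_cases hz : (0 : ℂ) ∈ f '' ball 0 1
  · have hc : IsCompact {z | z ∈ ball (0 : ℂ) 1 ∧ f z = 0} := by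
      simpa using hfp.isCompact_preimage isCompact_singleton (Set.singleton_subset_iff.2 hz)
    by_contra hinf
    obtain ⟨x, hx, hacc⟩ := Set.Infinite.exists_accPt_of_subset_isCompact hinf hc subset_rfl
    refine h0 (hf.eqOn_zero_of_preconnected_of_frequently_eq_zero
      (convex_ball (0 : ℂ) 1).isPreconnected hx.1 ?_ (mem_ball_self one_pos))
    exact (accPt_iff_frequently_nhdsNE.1 hacc).mono fun y hy => hy.2
  · convert Set.finite_empty
    exact Set.eq_empty_iff_forall_notMem.2 fun z hz' => hz ⟨z, hz'⟩

/-! ### Maximum principle on the fibre product -/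

open Filter Topology in
/-- **Maximum principle on the fibre product** of a holomorphic `g` and a proper `f`: if
`‖P z‖ * ‖p z * q w‖ ≤ 1` whenever `f w = g z`, where `P` has modulus close to `1` near the unit
circle, then already `‖p z * q w‖ ≤ 1` whenever `f w = g z`. -/
theorem norm_mul_le_one_of_fiberProduct {f g p q P : ℂ → ℂ} (hfp : IsProperOnDisc f)
    (hf : AnalyticOnNhd ℂ f (ball 0 1)) (hg : AnalyticOnNhd ℂ g (ball 0 1))
    (hgf : g '' ball 0 1 ⊆ f '' ball 0 1)
    (hp : AnalyticOnNhd ℂ p (ball 0 1)) (hq : AnalyticOnNhd ℂ q (ball 0 1))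
    (hbd : ∀ z ∈ ball (0 : ℂ) 1, ∀ w ∈ ball (0 : ℂ) 1, f w = g z → ‖P z‖ * ‖p z * q w‖ ≤ 1)
    (hP : ∀ c < (1 : ℝ), ∃ r < 1, ∀ z : ℂ, r < ‖z‖ → ‖z‖ < 1 → c < ‖P z‖)
    {z₀ w₀ : ℂ} (hz₀ : z₀ ∈ ball (0 : ℂ) 1) (hw₀ : w₀ ∈ ball (0 : ℂ) 1) (h₀ : f w₀ = g z₀) :
    ‖p z₀ * q w₀‖ ≤ 1 := by
  by_contra! hR
  set R := ‖p z₀ * q w₀‖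
  obtain ⟨r', hr', hPr⟩ := hP R⁻¹ (inv_lt_one_of_one_lt₀ hR)
  have hlt : ∀ z ∈ ball (0 : ℂ) 1, ∀ w ∈ ball (0 : ℂ) 1, f w = g z → r' < ‖z‖ →
      ‖p z * q w‖ < R := by
    intro z hz w hw h hrz
    have h1 := hPr z hrz (mem_ball_zero_iff.1 hz)
    have h2 := hbd z hz w hw h
    by_contra! hle
    have : R⁻¹ * R < ‖P z‖ * ‖p z * q w‖ :=
      mul_lt_mul h1 hle (by positivity) (norm_nonneg _)
    rw [inv_mul_cancel₀ (by positivity)] at this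
    exact this.not_ge h2
  set r := max r' ‖z₀‖
  have hr1 : r < 1 := max_lt hr' (mem_ball_zero_iff.1 hz₀)
  have hrb : closedBall (0 : ℂ) r ⊆ ball 0 1 := closedBall_subset_ball hr1
  have hgc : IsCompact (g '' closedBall 0 r) :=
    (isCompact_closedBall 0 r).image_of_continuousOn (hg.continuousOn.mono hrb)
  -- Properness keeps `w` in a compact part of the disc while `z` stays in the smaller closed disc.
  have hL := hfp.isCompact_preimage hgc ((Set.image_mono hrb).trans hgf)
  set L := {w | w ∈ ball (0 : ℂ) 1 ∧ f w ∈ g '' closedBall 0 r}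
  have hA : IsCompact (closedBall (0 : ℂ) r ×ˢ L) := (isCompact_closedBall 0 r).prod hL
  have hm1 : Set.MapsTo Prod.fst (closedBall (0 : ℂ) r ×ˢ L) (ball 0 1) := fun x hx => hrb hx.1
  have hm2 : Set.MapsTo Prod.snd (closedBall (0 : ℂ) r ×ˢ L) (ball 0 1) := fun x hx => hx.2.1
  have hV : IsCompact {x | x ∈ closedBall (0 : ℂ) r ×ˢ L ∧ f x.2 - g x.1 ∈ ({0} : Set ℂ)} :=
    hA.of_isClosed_subset (ContinuousOn.preimage_isClosed_of_isClosed
      ((hf.continuousOn.comp continuousOn_snd hm2).sub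
        (hg.continuousOn.comp continuousOn_fst hm1)) hA.isClosed isClosed_singleton) fun x hx => hx.1
  set V := {x | x ∈ closedBall (0 : ℂ) r ×ˢ L ∧ f x.2 - g x.1 ∈ ({0} : Set ℂ)}
  have hVmem : ∀ z ∈ closedBall (0 : ℂ) r, ∀ w ∈ ball (0 : ℂ) 1, f w = g z → (z, w) ∈ V :=
    fun z hz w hw h => ⟨⟨hz, hw, z, hz, h.symm⟩, by simp [h]⟩
  have hx₀ : (z₀, w₀) ∈ V := hVmem z₀ (by simp [r]) w₀ hw₀ h₀
  have hRc : ContinuousOn (fun x : ℂ × ℂ => ‖p x.1 * q x.2‖) V :=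
    (((hp.continuousOn.comp continuousOn_fst hm1).mul
      (hq.continuousOn.comp continuousOn_snd hm2)).norm).mono fun x hx => hx.1
  obtain ⟨x₁, hx₁, hmax⟩ := hV.exists_isMaxOn ⟨_, hx₀⟩ hRc
  set M := ‖p x₁.1 * q x₁.2‖
  have hRM : R ≤ M := hmax hx₀
  have hM : IsCompact {x | x ∈ V ∧ ‖p x.1 * q x.2‖ ∈ ({M} : Set ℝ)} :=
    hV.of_isClosed_subset (hRc.preimage_isClosed_of_isClosed hV.isClosed isClosed_singleton)
      fun x hx => hx.1
  -- Among the points of `V` where the maximum `M` is attained, take one with `‖z‖` largest. Local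
  -- constancy at this point will then be contradictory, with no need for connectedness.
  obtain ⟨⟨z, w⟩, ⟨hx, hxM⟩, hzmax⟩ :=
    hM.exists_isMaxOn ⟨x₁, hx₁, rfl⟩ (continuous_fst.norm).continuousOn
  have hz : z ∈ ball (0 : ℂ) 1 := hm1 hx.1
  have hw : w ∈ ball (0 : ℂ) 1 := hm2 hx.1
  have hwz : f w = g z := by simpa [sub_eq_zero] using hx.2
  replace hxM : ‖p z * q w‖ = M := hxM
  obtain ⟨k, hk, h, hh, hh0, hlift⟩ :=
    (hf w hw).exists_local_lift (hg z hz) hwz (hfp.not_eventually_eq hf hw)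
  set t : ℂ → ℂ := fun s => z + s ^ k
  have ht : AnalyticAt ℂ t 0 := analyticAt_const.add (analyticAt_id.pow k)
  have ht0 : t 0 = z := by simp [t, hk]
  have htb : ∀ᶠ s in 𝓝 (0 : ℂ), t s ∈ ball (0 : ℂ) 1 :=
    ht.continuousAt.eventually (by rw [ht0]; exact isOpen_ball.mem_nhds hz)
  have hhb : ∀ᶠ s in 𝓝 (0 : ℂ), h s ∈ ball (0 : ℂ) 1 :=
    hh.continuousAt.eventually (by rw [hh0]; exact isOpen_ball.mem_nhds hw)
  set F : ℂ → ℂ := fun s => p (t s) * q (h s)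
  have hF : AnalyticAt ℂ F 0 :=
    (AnalyticAt.fun_comp (by rw [ht0]; exact hp z hz) ht).mul
      (AnalyticAt.fun_comp (by rw [hh0]; exact hq w hw) hh)
  have hF0 : ‖F 0‖ = M := by simp only [F, ht0, hh0, hxM]
  -- The lifted disc may leave `V`, but then `‖t s‖ > r ≥ r'`, where the modulus is below `R ≤ M`.
  have hFle : ∀ᶠ s in 𝓝 (0 : ℂ), ‖F s‖ ≤ ‖F 0‖ := by
    filter_upwards [hlift, htb, hhb] with s h1 h2 h3
    rw [hF0]
    by_cases hs : t s ∈ closedBall (0 : ℂ) r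
    · exact hmax (hVmem _ hs _ h3 h1)
    · refine (hlt _ h2 _ h3 h1 ?_).le.trans hRM
      rw [mem_closedBall_zero_iff, not_le] at hs
      exact (le_max_left _ _).trans_lt hs
  have hFc := Complex.eventually_eq_of_isLocalMax_norm
    (hF.eventually_analyticAt.mono fun s hs => hs.differentiableAt) hFle
  -- Since `F` is locally constant, nearby points of the disc also attain `M`, so `‖t s‖` has a
  -- local maximum at `0`. This is impossible for the nonconstant `t s = z + s ^ k`.
  have htle : ∀ᶠ s in 𝓝 (0 : ℂ), ‖t s‖ ≤ ‖t 0‖ := by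
    filter_upwards [hlift, htb, hhb, hFc] with s h1 h2 h3 h4
    have h5 : ‖p (t s) * q (h s)‖ = M := by rw [← hF0, ← h4]
    have hs : t s ∈ closedBall (0 : ℂ) r := by
      by_contra hs
      rw [mem_closedBall_zero_iff, not_le] at hs
      exact (hlt _ h2 _ h3 h1 ((le_max_left _ _).trans_lt hs)).not_ge (h5 ▸ hRM)
    rw [ht0]
    exact hzmax (show (t s, h s) ∈ _ from ⟨hVmem _ hs _ h3 h1, h5⟩)
  have htc := Complex.eventually_eq_of_isLocalMax_norm
    (ht.eventually_analyticAt.mono fun s hs => hs.differentiableAt) htle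
  obtain ⟨s, hs, hs0⟩ :=
    ((htc.filter_mono nhdsWithin_le_nhds).and (eventually_mem_nhdsWithin (a := (0 : ℂ))
      (s := {0}ᶜ))).exists
  simp [t, hk] at hs
  exact hs0 hs

/-- Comparison at the origin of the Blaschke products of `f` and `g`. -/
theorem norm_zeroProduct_le_of_isProperOnDisc {f g : ℂ → ℂ} (hfp : IsProperOnDisc f)
    (hf : AnalyticOnNhd ℂ f (ball 0 1)) (hg : AnalyticOnNhd ℂ g (ball 0 1))
    (hgf : g '' ball 0 1 ⊆ f '' ball 0 1) (h0 : g 0 = f 0)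
    (hordf : ∀ b ∈ ball (0 : ℂ) 1, analyticOrderAt f b ≠ ⊤)
    (hordg : ∀ b ∈ ball (0 : ℂ) 1, analyticOrderAt g b ≠ ⊤)
    {S T : Finset ℂ} (hS : ∀ z, z ∈ S ↔ z ∈ ball (0 : ℂ) 1 ∧ f z = 0) (hT : ∀ b ∈ T, ‖b‖ < 1) :
    ‖zeroProduct f S 0‖ ≤ ‖zeroProduct g T 0‖ := by
  have hS1 : ∀ b ∈ S, ‖b‖ < 1 := fun b hb => mem_ball_zero_iff.1 ((hS b).1 hb).1
  have h0b : (0 : ℂ) ∈ ball (0 : ℂ) 1 := mem_ball_self one_pos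
  obtain ⟨f₁, hf₁, hf₁S, hff₁⟩ := exists_eq_zeroProduct_mul hf S hS1 hordf
  obtain ⟨g₁, hg₁, -, hgg₁⟩ := exists_eq_zeroProduct_mul hg T hT hordg
  have hf₁0 : ∀ z ∈ ball (0 : ℂ) 1, f₁ z ≠ 0 := fun z hz h =>
    hf₁S z ((hS z).2 ⟨hz, by rw [hff₁ z hz, h, mul_zero]⟩) h
  have key := norm_mul_le_one_of_fiberProduct (p := g₁) (q := f₁⁻¹) (P := zeroProduct g T)
    hfp hf hg hgf hg₁ (hf₁.inv hf₁0) ?_ (fun c hc => exists_lt_norm_zeroProduct hT hc) h0b h0b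
    h0.symm
  · have hg0 := hgg₁ 0 h0b
    rw [h0, hff₁ 0 h0b] at hg0
    rw [Pi.inv_apply, norm_mul, norm_inv, ← div_eq_mul_inv,
      div_le_one (norm_pos_iff.2 (hf₁0 0 h0b))] at key
    have hn := congrArg norm hg0
    rw [norm_mul, norm_mul] at hn
    have hpos := norm_pos_iff.2 (hf₁0 0 h0b)
    -- Uses `B_f 0 * f₁ 0 = B_g 0 * g₁ 0` together with `‖g₁ 0‖ ≤ ‖f₁ 0‖`.
    refine le_of_mul_le_mul_right ?_ hpos
    rw [hn]
    exact mul_le_mul_of_nonneg_left key (norm_nonneg _)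
  · intro z hz w hw h
    have : zeroProduct g T z * (g₁ z * f₁⁻¹ w) = zeroProduct f S w := by
      rw [← mul_assoc, ← hgg₁ z hz, ← h, hff₁ w hw, Pi.inv_apply,
        mul_inv_cancel_right₀ (hf₁0 w hw)]
    rw [← norm_mul, this]
    exact norm_zeroProduct_le_one hS1 (mem_ball_zero_iff.1 hw).le

/-! ### Zero sums as logarithms of Blaschke products -/

theorem zeroTerm_eq_coe {h : ℂ → ℂ} {b : ℂ} (hb : b ≠ 0) (hord : analyticOrderAt h b ≠ ⊤) :
    zeroTerm h b = ((analyticOrderNatAt h b * Real.log ‖b‖ : ℝ) : EReal) := by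
  rw [zeroTerm, ← Nat.cast_analyticOrderNatAt hord, ENat.toENNReal_coe, ← ofReal_norm,
    ENNReal.log_ofReal_of_pos (norm_pos_iff.2 hb), EReal.coe_mul]
  rfl

/-- Each Blaschke factor takes the value `-b` at the origin; `b ≠ 0` and finite orders keep every
term real. -/
theorem sum_zeroTerm_eq_log_norm_zeroProduct {h : ℂ → ℂ} {S : Finset ℂ} (hS : ∀ b ∈ S, b ≠ 0)
    (hord : ∀ b ∈ S, analyticOrderAt h b ≠ ⊤) :
    ∑ b ∈ S, zeroTerm h b = (Real.log ‖zeroProduct h S 0‖ : EReal) := by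
  have hlog : Real.log ‖zeroProduct h S 0‖ =
      ∑ b ∈ S, analyticOrderNatAt h b * Real.log ‖b‖ := by
    simp only [zeroProduct, blaschkeFactor_zero, norm_prod, norm_pow, norm_neg]
    rw [Real.log_prod fun b hb => pow_ne_zero _ (norm_ne_zero_iff.2 (hS b hb))]
    simp [Real.log_pow]
  rw [hlog, Finset.sum_congr rfl fun b hb => zeroTerm_eq_coe (hS b hb) (hord b hb)]
  exact (map_sum (⟨⟨(↑), EReal.coe_zero⟩, EReal.coe_add⟩ : ℝ →+ EReal) _ S).symm

/-- The terms are nonpositive, so adding more of them only lowers the partial sums. -/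
theorem zeroLogSum_le_sum (h : ℂ → ℂ) (S : Finset ℂ) (hS : ∀ b ∈ S, b ∈ ball (0 : ℂ) 1 ∧ h b = 0) :
    zeroLogSum h ≤ ∑ b ∈ S, zeroTerm h b := by
  classical
  rw [← Finset.sum_subtype_of_mem (zeroTerm h) hS]
  refine le_of_tendsto (hasSum_zeroLogSum h) (Filter.eventually_atTop.2
    ⟨S.subtype _, fun t hst => ?_⟩)
  rw [← Finset.sum_sdiff hst]
  exact (add_le_add_left (Finset.sum_nonpos fun b _ => zeroTerm_nonpos h b.2.1) _).trans
    (zero_add _).le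

/-- Reduces a lower bound to finite sets of zeros, so that only finite Blaschke products are needed
for `g`. -/
theorem le_zeroLogSum {h : ℂ → ℂ} {c : EReal}
    (hc : ∀ S : Finset ℂ, (∀ b ∈ S, b ∈ ball (0 : ℂ) 1 ∧ h b = 0) → c ≤ ∑ b ∈ S, zeroTerm h b) :
    c ≤ zeroLogSum h := by
  refine ge_of_tendsto' (hasSum_zeroLogSum h) fun t => ?_
  have := hc (t.map (Function.Embedding.subtype _)) (by simp +contextual)
  rwa [Finset.sum_map] at this

theorem zeroLogSum_eq_bot {h : ℂ → ℂ} (hh : AnalyticAt ℂ h 0) (h0 : h 0 = 0) :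
    zeroLogSum h = ⊥ := by
  refine le_bot_iff.1 ((zeroLogSum_le_sum h {0} (by simp [h0])).trans_eq ?_)
  have hpos : (0 : EReal) < ((analyticOrderAt h 0 : ENat) : ENNReal) := by
    rw [EReal.coe_ennreal_pos, pos_iff_ne_zero, ne_eq, ENat.toENNReal_eq_zero]
    exact analyticOrderAt_ne_zero.2 ⟨hh, h0⟩
  simp [zeroTerm, EReal.mul_bot_of_pos hpos]

theorem analyticOrderAt_ne_top_of_apply_zero_ne_zero {h : ℂ → ℂ}
    (hh : AnalyticOnNhd ℂ h (ball 0 1)) (h0 : h 0 ≠ 0) {b : ℂ} (hb : b ∈ ball (0 : ℂ) 1) :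
    analyticOrderAt h b ≠ ⊤ :=
  hh.analyticOrderAt_ne_top_of_isPreconnected (convex_ball (0 : ℂ) 1).isPreconnected
    (mem_ball_self one_pos) hb (by rw [analyticOrderAt_eq_zero.2 (Or.inr h0)]; simp)

/-- **Lindelöf's principle** for a proper holomorphic function on the disc. -/
theorem IsProperOnDisc.zeroLogSum_le {f g : ℂ → ℂ} (hfp : IsProperOnDisc f)
    (hf : AnalyticOnNhd ℂ f (ball 0 1)) (hg : AnalyticOnNhd ℂ g (ball 0 1))
    (hgf : g '' ball 0 1 ⊆ f '' ball 0 1) (h0 : g 0 = f 0) : zeroLogSum f ≤ zeroLogSum g := by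
  by_cases hf0 : f 0 = 0
  · rw [zeroLogSum_eq_bot (hf 0 (mem_ball_self one_pos)) hf0]
    exact bot_le
  have hg0 : g 0 ≠ 0 := h0 ▸ hf0
  have hfin := hfp.finite_zeros hf hf0
  have hS : ∀ z, z ∈ hfin.toFinset ↔ z ∈ ball (0 : ℂ) 1 ∧ f z = 0 := fun z => by simp
  have hordf := fun b hb => analyticOrderAt_ne_top_of_apply_zero_ne_zero hf hf0 (b := b) hb
  have hordg := fun b hb => analyticOrderAt_ne_top_of_apply_zero_ne_zero hg hg0 (b := b) hb
  have hne : ∀ {h : ℂ → ℂ} {b : ℂ}, h 0 ≠ 0 → h b = 0 → b ≠ 0 := by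
    rintro h b h1 h2 rfl
    exact h1 h2
  refine le_zeroLogSum fun T hT => (zeroLogSum_le_sum f hfin.toFinset fun b => (hS b).1).trans ?_
  rw [sum_zeroTerm_eq_log_norm_zeroProduct (fun b hb => hne hf0 ((hS b).1 hb).2)
      fun b hb => hordf b ((hS b).1 hb).1,
    sum_zeroTerm_eq_log_norm_zeroProduct (fun b hb => hne hg0 (hT b hb).2)
      fun b hb => hordg b (hT b hb).1, EReal.coe_le_coe_iff]
  refine Real.log_le_log (norm_pos_iff.2 (zeroProduct_ne_zero (fun b hb =>
    mem_ball_zero_iff.1 ((hS b).1 hb).1) (by simp) fun h => hf0 ((hS 0).1 h).2)) ?_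
  exact norm_zeroProduct_le_of_isProperOnDisc hfp hf hg hgf h0 hordf hordg hS fun b hb =>
    mem_ball_zero_iff.1 (hT b hb).1

theorem theorem3 (f : ℂ → ℂ)
    (hf : DifferentiableOn ℂ f (ball 0 1))
    (hfc : ContinuousOn f (closedBall 0 1))
    (hfp : IsProperOnDisc f)
    (g : ℂ → ℂ)
    (hg : DifferentiableOn ℂ g (ball 0 1))
    (hgf : g '' ball 0 1 ⊆ f '' ball 0 1)
    (h0 : g 0 = f 0) :
    zeroLogSum g ≥ zeroLogSum f ∧
      (IsProperOnDisc g → g '' ball 0 1 = f '' ball 0 1 → zeroLogSum g = zeroLogSum f) := by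
  have hfa := hf.analyticOnNhd isOpen_ball
  have hga := hg.analyticOnNhd isOpen_ball
  have hle := hfp.zeroLogSum_le hfa hga hgf h0
  -- For equality the roles of `f` and `g` are exchanged.
  exact ⟨hle, fun hgp heq => (hgp.zeroLogSum_le hga hfa heq.ge h0.symm).antisymm hle⟩
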